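/- Let $N\ge 3$ be an integer, $M>0$ and $r_0>0$. Let $u$ be a radial (classical) solution of $$-\Delta u+M|\nabla u|^q-e^u=0\qquad\text{in the exterior domain }\{x\in\mathbb R^N:\ |x|>r_0\},$$ and write $u=u(r)$ with $r=|x|$, so that $-u_{rr}-\frac{N-1}{r}u_r+M|u_r|^q-e^u=0$ for $r>r_0$. 1. If $1<q<2$, then $\displaystyle\lim_{r\to\infty}r^qe^{u(r)}=Mq^q$ and $\displaystyle\lim_{r\to\infty}ru_r(r)=-q$. 2. If $q>2$, then $\displaystyle\lim_{r\to\infty}r^2e^{u(r)}=2(N-2)$ and $\displaystyle\lim_{r\to\infty}ru_r(r)=-2$. -/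

import Mathlib

/-- `U` is a classical (`C²`) solution of `-Δ U + M |∇ U|^q - e^U = 0` in the (open) set `Ω ⊆ ℝ^N`. -/
def IsSolutionIn {N : ℕ} (M q : ℝ) (U : EuclideanSpace ℝ (Fin N) → ℝ)
    (Ω : Set (EuclideanSpace ℝ (Fin N))) : Prop :=
  ContDiffOn ℝ 2 U Ω ∧
    ∀ x ∈ Ω, -Laplacian.laplacian U x + M * ‖gradient U x‖ ^ q - Real.exp (U x) = 0

/-- The exterior domain `{x ∈ ℝ^N : |x| > r₀}`. -/
def exteriorDomain (N : ℕ) (r₀ : ℝ) : Set (EuclideanSpace ℝ (Fin N)) :=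
  {x | r₀ < ‖x‖}

/-- `U` is radial in `Ω` with profile `u`, that is, `U x = u |x|` for `x ∈ Ω`. -/
def IsRadialIn {N : ℕ} (U : EuclideanSpace ℝ (Fin N) → ℝ)
    (Ω : Set (EuclideanSpace ℝ (Fin N))) (u : ℝ → ℝ) : Prop :=
  ∀ x ∈ Ω, U x = u ‖x‖

/-!
In the variable `t = log r`, with `s t = u (e^t)` and `x t = -r u'(r)`, the radial equation becomes
`s' = -x`, `x' = -n x + e^{s + 2t} - M e^{(2-q)t} |x|^q`, where `n = N - 2 > 0`. A solution that
increases on a whole half-line would blow up or turn around in finite time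
(`IsLogTrajectory.exists_nonneg`), and `x' > 0` wherever `x = 0`. So `x ≥ 0` from some time on.

Let `q > 2` and `z = s + 2t`. Then `z' = 2 - x` and the gradient term decays exponentially as long
as `x` is bounded. The function `(x - 2)² / 2 + e^z - 2 n z` has derivative `-n (x - 2)²` minus
`M e^{-(q-2)t} x^q (x - 2)`. The second part is harmless for `x ≥ 2` and integrable for `x ≤ 2`. Hence
`x` and `z` are bounded and the Lyapunov function converges. Barbalat's lemma
(`tendsto_zero_of_tendsto_of_hasDerivAt_add`) gives `x → 2`, and a second use of it, on the
equation for `x`, gives `e^z → 2 n`.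

Let `1 < q < 2` and `z = s + qt`. Then `z' = q - x`, and `x` is a fast variable:
`x' = -n x + e^{(2-q)t} (e^z - M x^q)`. The function `e^{-(2-q)t} (x - q)² / 2 + e^z - M q^q z` is
bounded above along the solution, because its derivative is at most a multiple of `e^{-(2-q)t}`.
This bounds `z`. With `M p^q = e^z`, the fast equation forces `x - p → 0`
(`tendsto_sub_of_fast_slow`), and then `p' = p (q - x) / q` is asymptotically the logistic equation
`p' = p (q - p) / q`, so `p → q` (`tendsto_of_slow`).
-/

/-! ### Gradient and Laplacian of a radial function -/

theorem hasDerivAt_norm_add_smul {E : Type*} [NormedAddCommGroup E] [InnerProductSpace ℝ E]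
    {x : E} (hx : x ≠ 0) (v : E) :
    HasDerivAt (fun t : ℝ => ‖x + t • v‖) (inner ℝ x v / ‖x‖) 0 := by
  have h1 : HasDerivAt (fun t : ℝ => x + t • v) v 0 := by
    simpa using ((hasDerivAt_id (0 : ℝ)).smul_const v).const_add x
  have h2 := (h1.norm_sq).sqrt (by simpa using hx)
  simp only [Real.sqrt_sq (norm_nonneg _), zero_smul, add_zero] at h2
  convert h2 using 1
  field_simp

section Radial

variable {N : ℕ} {r₀ : ℝ} {U : EuclideanSpace ℝ (Fin N) → ℝ} {u : ℝ → ℝ}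

theorem isOpen_exteriorDomain (N : ℕ) (r₀ : ℝ) : IsOpen (exteriorDomain N r₀) :=
  isOpen_lt continuous_const continuous_norm

/-- The profile inherits the regularity of `U`, being its restriction to a ray. -/
theorem IsRadialIn.contDiffOn (hN : 0 < N) (hr₀ : 0 ≤ r₀)
    (hu : IsRadialIn U (exteriorDomain N r₀) u)
    (hU : ContDiffOn ℝ 2 U (exteriorDomain N r₀)) : ContDiffOn ℝ 2 u (Set.Ioi r₀) := by
  let e : EuclideanSpace ℝ (Fin N) := EuclideanSpace.single ⟨0, hN⟩ 1
  have he : ‖e‖ = 1 := by simp [e]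
  have hn : ∀ r ∈ Set.Ioi r₀, ‖r • e‖ = r := fun r hr => by
    rw [norm_smul, he, mul_one, Real.norm_of_nonneg (hr₀.trans (le_of_lt hr))]
  have hm : Set.MapsTo (fun r : ℝ => r • e) (Set.Ioi r₀) (exteriorDomain N r₀) := fun r hr => by
    change r₀ < ‖r • e‖
    rw [hn r hr]
    exact hr
  refine (hU.comp (contDiff_id.smul contDiff_const).contDiffOn hm).congr fun r hr => ?_
  change u r = U (r • e)
  rw [hu _ (hm hr), hn r hr]

/-- For `U = u ∘ ‖·‖`, the derivative at `x` in the direction `v` is `u'(‖x‖) ⟪x, v⟫ / ‖x‖`. -/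
theorem IsRadialIn.fderiv_apply (hr₀ : 0 ≤ r₀)
    (hu : IsRadialIn U (exteriorDomain N r₀) u)
    (hU : ContDiffOn ℝ 2 U (exteriorDomain N r₀)) (hN : 0 < N)
    {x : EuclideanSpace ℝ (Fin N)} (hx : x ∈ exteriorDomain N r₀)
    (v : EuclideanSpace ℝ (Fin N)) :
    fderiv ℝ U x v = deriv u ‖x‖ * (inner ℝ x v / ‖x‖) := by
  have hx0 : x ≠ 0 := norm_pos_iff.1 (hr₀.trans_lt hx)
  have hUx : DifferentiableAt ℝ U x :=
    (hU.contDiffAt ((isOpen_exteriorDomain N r₀).mem_nhds hx)).differentiableAt (by norm_num)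
  have hux : DifferentiableAt ℝ u ‖x‖ :=
    ((hu.contDiffOn hN hr₀ hU).contDiffAt (Ioi_mem_nhds hx)).differentiableAt (by norm_num)
  have hl : HasDerivAt (fun t : ℝ => x + t • v) v 0 := by
    simpa using ((hasDerivAt_id (0 : ℝ)).smul_const v).const_add x
  have h1 : HasDerivAt (fun t : ℝ => U (x + t • v)) (fderiv ℝ U x v) 0 := by
    refine HasFDerivAt.comp_hasDerivAt (f := fun t : ℝ => x + t • v) (0 : ℝ) ?_ hl
    simpa using hUx.hasFDerivAt
  have h2 : HasDerivAt (fun t : ℝ => u ‖x + t • v‖) (deriv u ‖x‖ * (inner ℝ x v / ‖x‖)) 0 := by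
    refine HasDerivAt.comp (h := fun t : ℝ => ‖x + t • v‖) (0 : ℝ) ?_
      (hasDerivAt_norm_add_smul hx0 v)
    simpa using hux.hasDerivAt
  refine h1.unique (h2.congr_of_eventuallyEq ?_)
  have : ∀ᶠ t in nhds (0 : ℝ), x + t • v ∈ exteriorDomain N r₀ := by
    refine hl.continuousAt.eventually_mem ((isOpen_exteriorDomain N r₀).mem_nhds ?_)
    simpa using hx
  filter_upwards [this] with t ht using hu _ ht

theorem IsRadialIn.norm_gradient (hr₀ : 0 ≤ r₀)
    (hu : IsRadialIn U (exteriorDomain N r₀) u)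
    (hU : ContDiffOn ℝ 2 U (exteriorDomain N r₀)) (hN : 0 < N)
    {x : EuclideanSpace ℝ (Fin N)} (hx : x ∈ exteriorDomain N r₀) :
    ‖gradient U x‖ = |deriv u ‖x‖| := by
  have hx0 : 0 < ‖x‖ := hr₀.trans_lt hx
  have : gradient U x = (deriv u ‖x‖ / ‖x‖) • x := by
    refine ext_inner_right ℝ fun v => ?_
    rw [gradient, InnerProductSpace.toDual_symm_apply, hu.fderiv_apply hr₀ hU hN hx, inner_smul_left]
    simp
    ring
  rw [this, norm_smul, Real.norm_eq_abs, abs_div, abs_of_pos hx0, div_mul_cancel₀ _ hx0.ne']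

theorem IsRadialIn.laplacian (hr₀ : 0 ≤ r₀)
    (hu : IsRadialIn U (exteriorDomain N r₀) u)
    (hU : ContDiffOn ℝ 2 U (exteriorDomain N r₀)) (hN : 0 < N)
    {x : EuclideanSpace ℝ (Fin N)} (hx : x ∈ exteriorDomain N r₀) :
    Laplacian.laplacian U x = deriv (deriv u) ‖x‖ + (N - 1) / ‖x‖ * deriv u ‖x‖ := by
  have hxp : 0 < ‖x‖ := hr₀.trans_lt hx
  have hx0 : x ≠ 0 := norm_pos_iff.1 hxp
  have hUx : DifferentiableAt ℝ (fderiv ℝ U) x :=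
    ((hU.contDiffAt ((isOpen_exteriorDomain N r₀).mem_nhds hx)).fderiv_right
      (m := 1) (by norm_num)).differentiableAt (by norm_num)
  have hux : DifferentiableAt ℝ (deriv u) ‖x‖ :=
    (((hu.contDiffOn hN hr₀ hU).contDiffAt (Ioi_mem_nhds hx)).derivWithin
      (m := 1) (by norm_num)).differentiableAt (by norm_num)
  -- the second derivative along `v`; the sum over an orthonormal basis gives the trace
  have key : ∀ v : EuclideanSpace ℝ (Fin N), fderiv ℝ (fderiv ℝ U) x v v =
      (deriv (deriv u) ‖x‖ / ‖x‖ ^ 2 - deriv u ‖x‖ / ‖x‖ ^ 3) * inner ℝ x v ^ 2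
        + deriv u ‖x‖ / ‖x‖ * ‖v‖ ^ 2 := by
    intro v
    have hl : HasDerivAt (fun t : ℝ => x + t • v) v 0 := by
      simpa using ((hasDerivAt_id (0 : ℝ)).smul_const v).const_add x
    have h1 : HasDerivAt (fun t : ℝ => fderiv ℝ U (x + t • v) v)
        (fderiv ℝ (fderiv ℝ U) x v v) 0 := by
      have : HasDerivAt (fun t : ℝ => fderiv ℝ U (x + t • v)) (fderiv ℝ (fderiv ℝ U) x v) 0 := by
        refine HasFDerivAt.comp_hasDerivAt (f := fun t : ℝ => x + t • v) (0 : ℝ) ?_ hl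
        simpa using hUx.hasFDerivAt
      simpa using this.clm_apply (hasDerivAt_const (0 : ℝ) v)
    have hn := hasDerivAt_norm_add_smul hx0 v
    have h2 : HasDerivAt (fun t : ℝ => deriv u ‖x + t • v‖)
        (deriv (deriv u) ‖x‖ * (inner ℝ x v / ‖x‖)) 0 := by
      refine HasDerivAt.comp (h₂ := deriv u) (h := fun t : ℝ => ‖x + t • v‖) (0 : ℝ) ?_ hn
      simpa using hux.hasDerivAt
    have h3 : HasDerivAt (fun t : ℝ => inner ℝ (x + t • v) v) (‖v‖ ^ 2) 0 := by
      simpa using hl.inner ℝ (hasDerivAt_const (0 : ℝ) v)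
    have h4 := h2.mul (h3.div hn (by simpa using hx0))
    refine (h1.unique (h4.congr_of_eventuallyEq ?_)).trans ?_
    · have : ∀ᶠ t in nhds (0 : ℝ), x + t • v ∈ exteriorDomain N r₀ := by
        refine hl.continuousAt.eventually_mem ((isOpen_exteriorDomain N r₀).mem_nhds ?_)
        simpa using hx
      filter_upwards [this] with t ht using hu.fderiv_apply hr₀ hU hN ht v
    · simp only [zero_smul, add_zero, Pi.div_apply]
      field_simp
      ring
  rw [InnerProductSpace.laplacian_eq_iteratedFDeriv_orthonormalBasis U
    (EuclideanSpace.basisFun (Fin N) ℝ)]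
  simp only [iteratedFDeriv_two_apply, Matrix.cons_val_zero, Matrix.cons_val_one]
  simp only [key, OrthonormalBasis.norm_eq_one, Finset.sum_add_distrib, ← Finset.mul_sum]
  have := (EuclideanSpace.basisFun (Fin N) ℝ).sum_sq_inner_left x
  rw [this]
  simp
  field_simp
  ring

/-- The profile of a radial solution solves the radial form of the equation. -/
theorem IsSolutionIn.radial_ode {M q : ℝ} (hr₀ : 0 ≤ r₀) (hN : 0 < N)
    (hU : IsSolutionIn M q U (exteriorDomain N r₀))
    (hu : IsRadialIn U (exteriorDomain N r₀) u) {r : ℝ} (hr : r₀ < r) :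
    HasDerivAt u (deriv u r) r ∧ HasDerivAt (deriv u)
      (M * |deriv u r| ^ q - Real.exp (u r) - (N - 1) / r * deriv u r) r := by
  have hC := (hu.contDiffOn hN hr₀ hU.1).contDiffAt (Ioi_mem_nhds hr)
  have h2 : DifferentiableAt ℝ (deriv u) r :=
    (hC.derivWithin (m := 1) (by norm_num)).differentiableAt (by norm_num)
  refine ⟨(hC.differentiableAt (by norm_num)).hasDerivAt, ?_⟩
  suffices h : deriv (deriv u) r =
      M * |deriv u r| ^ q - Real.exp (u r) - (N - 1) / r * deriv u r by
    rw [← h]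
    exact h2.hasDerivAt
  let x : EuclideanSpace ℝ (Fin N) := EuclideanSpace.single ⟨0, hN⟩ r
  have hxr : ‖x‖ = r := by
    simpa [x] using abs_of_pos (hr₀.trans_lt hr)
  have hx : x ∈ exteriorDomain N r₀ := by
    change r₀ < ‖x‖
    rwa [hxr]
  have h := hU.2 x hx
  rw [hu.laplacian hr₀ hU.1 hN hx, hu.norm_gradient hr₀ hU.1 hN hx, hu x hx, hxr] at h
  linarith

end Radial

open Filter Topology


/-! ### Differential inequalities on a half-line -/

/-- A function whose derivative stays below a negative constant is unbounded below. -/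
theorem exists_lt_of_hasDerivAt_le_neg {f f' : ℝ → ℝ} {T η : ℝ} (hη : 0 < η)
    (hf : ∀ t, T ≤ t → HasDerivAt f (f' t) t) (hf' : ∀ t, T ≤ t → f' t ≤ -η) (b : ℝ) :
    ∃ t, T ≤ t ∧ f t < b := by
  have hd : 0 ≤ |f T - b| / η := by positivity
  refine ⟨T + 1 + |f T - b| / η, by linarith, ?_⟩
  obtain ⟨c, hc, hc'⟩ := exists_hasDerivAt_eq_slope f f'
    (show T < T + 1 + |f T - b| / η by linarith)
    (fun t ht => (hf t ht.1).continuousAt.continuousWithinAt) (fun t ht => hf t ht.1.le)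
  have h1 := hf' c hc.1.le
  rw [hc', div_le_iff₀ (by linarith)] at h1
  have h2 : η * (|f T - b| / η) = |f T - b| := by field_simp
  linarith [le_abs_self (f T - b)]

/-- A level that `f` can only cross downwards is a barrier. -/
theorem le_of_hasDerivAt_neg_of_eq {f f' : ℝ → ℝ} {T c : ℝ}
    (hf : ∀ t, T ≤ t → HasDerivAt f (f' t) t) (hT : f T ≤ c)
    (hc : ∀ t, T ≤ t → f t = c → f' t < 0) {t : ℝ} (ht : T ≤ t) : f t ≤ c :=
  image_le_of_deriv_right_lt_deriv_boundary (B' := fun _ => 0) (b := t)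
    (fun τ hτ => (hf τ hτ.1).continuousAt.continuousWithinAt)
    (fun τ hτ => (hf τ hτ.1).hasDerivWithinAt) hT (fun τ => hasDerivAt_const τ c)
    (fun τ hτ => hc τ hτ.1) ⟨ht, le_rfl⟩

/-- If `f` decreases at a definite rate wherever it is above the level `c`, then it ends up below
that level. -/
theorem eventually_le_of_hasDerivAt_le_neg {f f' : ℝ → ℝ} {c η : ℝ} (hη : 0 < η)
    (hf : ∀ᶠ t in atTop, HasDerivAt f (f' t) t) (hc : ∀ᶠ t in atTop, c ≤ f t → f' t ≤ -η) :
    ∀ᶠ t in atTop, f t ≤ c := by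
  obtain ⟨T, hT⟩ := eventually_atTop.1 (hf.and hc)
  obtain ⟨T₁, hT₁, hT₁c⟩ : ∃ t, T ≤ t ∧ f t ≤ c := by
    by_contra! h
    obtain ⟨t, ht, htc⟩ := exists_lt_of_hasDerivAt_le_neg hη (fun t ht => (hT t ht).1)
      (fun t ht => (hT t ht).2 (h t ht).le) c
    exact (h t ht).not_gt htc
  filter_upwards [eventually_ge_atTop T₁] with t ht
  refine le_of_hasDerivAt_neg_of_eq (fun t ht => (hT t (hT₁.trans ht)).1) hT₁c
    (fun t ht h => ?_) ht
  linarith [(hT t (hT₁.trans ht)).2 h.ge]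

theorem tendsto_of_forall_eventually_le {f : ℝ → ℝ} {l : ℝ}
    (hle : ∀ δ > 0, ∀ᶠ t in atTop, f t - l ≤ δ) (hge : ∀ δ > 0, ∀ᶠ t in atTop, l - f t ≤ δ) :
    Tendsto f atTop (𝓝 l) := by
  rw [Metric.tendsto_nhds]
  intro ε hε
  filter_upwards [hle (ε / 2) (by positivity), hge (ε / 2) (by positivity)] with t h1 h2
  rw [Real.dist_eq, abs_lt]
  constructor <;> linarith

/-- **Barbalat's lemma**, in a perturbed form: if `f` converges and `f' = g + h` with `g` of bounded
derivative and `h → 0`, then `g → 0`. -/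
theorem tendsto_zero_of_tendsto_of_hasDerivAt_add {f g g' h : ℝ → ℝ} {T l K : ℝ}
    (hf : ∀ t, T ≤ t → HasDerivAt f (g t + h t) t) (hg : ∀ t, T ≤ t → HasDerivAt g (g' t) t)
    (hK : ∀ t, T ≤ t → |g' t| ≤ K) (hl : Tendsto f atTop (𝓝 l)) (hh : Tendsto h atTop (𝓝 0)) :
    Tendsto g atTop (𝓝 0) := by
  have hK0 : 0 ≤ K := (abs_nonneg _).trans (hK T le_rfl)
  rw [Metric.tendsto_atTop]
  intro ε hε
  set τ := ε / (3 * (K + 1)) with hτ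
  have hτ0 : 0 < τ := by positivity
  have hKτ : K * τ ≤ ε / 3 := by
    rw [hτ, mul_div_assoc', div_le_div_iff₀ (by positivity) (by positivity)]
    nlinarith
  have hd : Tendsto (fun t => f (t + τ) - f t) atTop (𝓝 0) := by
    simpa using (hl.comp (tendsto_atTop_add_const_right _ τ tendsto_id)).sub hl
  obtain ⟨T₁, hT₁⟩ := Metric.tendsto_atTop.1 hd (ε / 3 * τ) (by positivity)
  obtain ⟨T₂, hT₂⟩ := Metric.tendsto_atTop.1 hh (ε / 3) (by positivity)
  refine ⟨max T (max T₁ T₂), fun t ht => ?_⟩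
  simp only [max_le_iff] at ht
  obtain ⟨c, hc, hc'⟩ := exists_hasDerivAt_eq_slope f (fun t => g t + h t)
    (show t < t + τ by linarith)
    (fun s hs => (hf s (ht.1.trans hs.1)).continuousAt.continuousWithinAt)
    (fun s hs => hf s (ht.1.trans hs.1.le))
  obtain ⟨d, hd, hd'⟩ := exists_hasDerivAt_eq_slope g g' hc.1
    (fun s hs => (hg s (ht.1.trans hs.1)).continuousAt.continuousWithinAt)
    (fun s hs => hg s (ht.1.trans hs.1.le))
  have h1 := hT₁ t ht.2.1
  have h2 := hT₂ c (ht.2.2.trans hc.1.le)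
  have h3 := hK d (ht.1.trans hd.1.le)
  simp only [Real.dist_eq, sub_zero] at h1 h2 ⊢
  rw [add_sub_cancel_left, eq_div_iff hτ0.ne'] at hc'
  rw [eq_div_iff (sub_pos.2 hc.1).ne'] at hd'
  rw [← hc', abs_mul, abs_of_pos hτ0, mul_lt_mul_iff_of_pos_right hτ0] at h1
  have h4 : |g c - g t| ≤ ε / 3 := by
    rw [← hd', abs_mul, abs_of_pos (sub_pos.2 hc.1)]
    exact (mul_le_mul h3 (by linarith [hc.2]) (sub_pos.2 hc.1).le hK0).trans hKτ
  rw [abs_lt] at h1 h2 ⊢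
  rw [abs_le] at h4
  constructor <;> linarith

/-- A function with `f' ≤ C e^{-εt}` decreases up to the correction `(C / ε) e^{-εt}`. -/
theorem antitoneOn_add_exp_of_hasDerivAt_le {f f' : ℝ → ℝ} {T C ε : ℝ} (hε : 0 < ε)
    (hf : ∀ t, T ≤ t → HasDerivAt f (f' t) t)
    (hf' : ∀ t, T ≤ t → f' t ≤ C * Real.exp (-(ε * t))) :
    AntitoneOn (fun t => f t + C / ε * Real.exp (-(ε * t))) (Set.Ici T) := by
  have hd : ∀ t, T ≤ t → HasDerivAt (fun t => f t + C / ε * Real.exp (-(ε * t)))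
      (f' t - C * Real.exp (-(ε * t))) t := by
    intro t ht
    have h := (hf t ht).add
      ((((hasDerivAt_id t).const_mul ε).neg.exp).const_mul (C / ε))
    refine h.congr_deriv ?_
    simp
    field_simp
    ring
  refine antitoneOn_of_deriv_nonpos (convex_Ici T)
    (fun t ht => (hd t ht).continuousAt.continuousWithinAt)
    (fun t ht => ?_) (fun t ht => ?_)
  all_goals rw [interior_Ici] at ht
  · exact (hd t ht.le).differentiableAt.differentiableWithinAt
  · rw [(hd t ht.le).deriv]
    linarith [hf' t ht.le]

theorem exists_le_of_hasDerivAt_le_exp {f f' : ℝ → ℝ} {T C ε : ℝ} (hε : 0 < ε) (hC : 0 ≤ C)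
    (hf : ∀ t, T ≤ t → HasDerivAt f (f' t) t)
    (hf' : ∀ t, T ≤ t → f' t ≤ C * Real.exp (-(ε * t))) :
    ∃ B, ∀ t, T ≤ t → f t ≤ B := by
  refine ⟨f T + C / ε * Real.exp (-(ε * T)), fun t ht => ?_⟩
  have h := antitoneOn_add_exp_of_hasDerivAt_le hε hf hf' Set.self_mem_Ici ht ht
  have : 0 ≤ C / ε * Real.exp (-(ε * t)) := by positivity
  simp only at h
  linarith

theorem exists_tendsto_of_hasDerivAt_le_exp {f f' : ℝ → ℝ} {T C ε B : ℝ} (hε : 0 < ε)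
    (hf : ∀ t, T ≤ t → HasDerivAt f (f' t) t)
    (hf' : ∀ t, T ≤ t → f' t ≤ C * Real.exp (-(ε * t))) (hB : ∀ t, T ≤ t → B ≤ f t)
    (hC : 0 ≤ C) :
    ∃ l, Tendsto f atTop (𝓝 l) := by
  set F := fun t => f t + C / ε * Real.exp (-(ε * t)) with hF
  have hanti := antitoneOn_add_exp_of_hasDerivAt_le hε hf hf'
  -- the constant extension to the left of `T` is antitone on the whole line
  have hG : Antitone (fun t => F (max T t)) := fun a b hab =>
    hanti (le_max_left T a) (le_max_left T b) (max_le_max le_rfl hab)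
  have hbdd : BddBelow (Set.range fun t => F (max T t)) := by
    refine ⟨B, ?_⟩
    rintro _ ⟨t, rfl⟩
    have : 0 ≤ C / ε * Real.exp (-(ε * max T t)) := by positivity
    simp only [hF]
    linarith [hB (max T t) (le_max_left _ _)]
  have hlim := tendsto_atTop_ciInf hG hbdd
  have hexp : Tendsto (fun t => C / ε * Real.exp (-(ε * t))) atTop (𝓝 0) := by
    have : Tendsto (fun t => Real.exp (-(ε * t))) atTop (𝓝 0) :=
      Real.tendsto_exp_neg_atTop_nhds_zero.comp (tendsto_id.const_mul_atTop hε)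
    simpa using this.const_mul (C / ε)
  refine ⟨_, (((hlim.sub hexp).congr' ?_))⟩
  filter_upwards [eventually_ge_atTop T] with t ht
  simp [hF, max_eq_right ht]

/-- Sublevel sets of `z ↦ e^z - a z` with `a > 0` are bounded. -/
theorem exists_abs_le_of_exp_sub_mul_le {a : ℝ} (ha : 0 < a) (C : ℝ) :
    ∃ Z, ∀ z : ℝ, Real.exp z - a * z ≤ C → |z| ≤ Z := by
  refine ⟨max (|C| / a) (2 * a + |C| + 1), fun z hz => ?_⟩
  have hC := le_abs_self C
  rcases le_total z 0 with h | h
  · rw [abs_of_nonpos h]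
    refine le_max_of_le_left ?_
    rw [le_div_iff₀ ha]
    linarith [Real.exp_pos z]
  · rw [abs_of_nonneg h]
    refine le_max_of_le_right ?_
    by_contra! hlt
    have h1 := Real.quadratic_le_exp_of_nonneg h
    have h2 := abs_nonneg C
    nlinarith

/-! ### The equation in the variable `t = log r` -/

/-- `s` and `x` are defined on `[T, ∞)` and solve `s' = -x`,
`x' = -n x + e^{s + 2t} - M e^{(2-q)t} |x|^q`. This is the radial equation in dimension `n + 2`
written in the variable `t = log r`, with `s t = u (e^t)` and `x t = -r u'(r)` at `r = e^t`. -/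
structure IsLogTrajectory (n M q T : ℝ) (s x : ℝ → ℝ) : Prop where
  hasDerivAt_fst : ∀ t, T ≤ t → HasDerivAt s (-x t) t
  hasDerivAt_snd : ∀ t, T ≤ t → HasDerivAt x
    (-(n * x t) + Real.exp (s t + 2 * t) - M * Real.exp ((2 - q) * t) * |x t| ^ q) t

namespace IsLogTrajectory

variable {n M q T : ℝ} {s x : ℝ → ℝ}

theorem mono (h : IsLogTrajectory n M q T s x) {T₁ : ℝ} (hT : T ≤ T₁) :
    IsLogTrajectory n M q T₁ s x :=
  ⟨fun t ht => h.1 t (hT.trans ht), fun t ht => h.2 t (hT.trans ht)⟩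

/-- A solution cannot increase on a whole half-line. Writing `w = -x = s'`, the quotient
`ρ = w e^{-s/q - t}` compares the two nonlinear terms. If `M ρ^q < 1` at one time, this persists,
and `w` falls below zero; if `M ρ^q ≥ 1` for all times, then `e^{-s/q}` falls below zero. -/
theorem exists_nonneg (h : IsLogTrajectory n M q T s x) (hn : 0 < n) (hM : 0 < M) (hq : 0 < q)
    (hT : 0 ≤ T) : ∃ t, T ≤ t ∧ 0 ≤ x t := by
  by_contra! hx
  set ρ : ℝ → ℝ := fun t => -x t * Real.exp (-(s t / q) - t) with hρ
  have hρ0 : ∀ t, T ≤ t → 0 < ρ t := fun t ht =>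
    mul_pos (neg_pos.2 (hx t ht)) (Real.exp_pos _)
  -- the equation for `w = -x`, with the nonlinear terms expressed through `ρ`
  have hw : ∀ t, T ≤ t → HasDerivAt (fun t => -x t)
      (n * x t - Real.exp (s t + 2 * t) * (1 - M * ρ t ^ q)) t := by
    intro t ht
    refine (h.2 t ht).neg.congr_deriv ?_
    have e1 : ρ t ^ q = |x t| ^ q * Real.exp (-s t - q * t) := by
      rw [hρ, Real.mul_rpow (neg_pos.2 (hx t ht)).le (Real.exp_pos _).le, ← Real.exp_mul,
        abs_of_neg (hx t ht)]
      congr 2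
      field_simp
    have e2 : Real.exp ((2 - q) * t) = Real.exp (s t + 2 * t) * Real.exp (-s t - q * t) := by
      rw [← Real.exp_add]
      congr 1
      ring
    rw [e1, e2]
    ring
  by_cases hcase : ∃ t₁, T ≤ t₁ ∧ M * ρ t₁ ^ q < 1
  · obtain ⟨t₁, ht₁, hlt⟩ := hcase
    have hρd : ∀ t, t₁ ≤ t → HasDerivAt ρ
        ((n * x t - Real.exp (s t + 2 * t) * (1 - M * ρ t ^ q)) * Real.exp (-(s t / q) - t) +
          -x t * (Real.exp (-(s t / q) - t) * (-(-x t / q) - 1))) t := fun t ht =>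
      (hw t (ht₁.trans ht)).mul
        ((((h.1 t (ht₁.trans ht)).div_const q).neg.sub (hasDerivAt_id t)).exp)
    have hρle : ∀ t, t₁ ≤ t → ρ t ≤ ρ t₁ := by
      intro t ht
      refine le_of_hasDerivAt_neg_of_eq hρd le_rfl (fun t ht heq => ?_) ht
      rw [heq]
      have hxt := hx t (ht₁.trans ht)
      have h1 : n * x t - Real.exp (s t + 2 * t) * (1 - M * ρ t₁ ^ q) < 0 := by
        have := mul_neg_of_pos_of_neg hn hxt
        have := mul_pos (Real.exp_pos (s t + 2 * t)) (sub_pos.2 hlt)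
        linarith
      have h2 : -(-x t / q) - 1 < 0 := by
        have := div_pos (neg_pos.2 hxt) hq
        linarith
      have h3 := mul_neg_of_neg_of_pos h1 (Real.exp_pos (-(s t / q) - t))
      have h4 := mul_neg_of_pos_of_neg (neg_pos.2 hxt)
        (mul_neg_of_pos_of_neg (Real.exp_pos (-(s t / q) - t)) h2)
      linarith
    have hs : ∀ t, t₁ ≤ t → s t₁ ≤ s t := by
      have : MonotoneOn s (Set.Ici t₁) := by
        refine monotoneOn_of_deriv_nonneg (convex_Ici t₁)
          (fun t ht => (h.1 t (ht₁.trans ht)).continuousAt.continuousWithinAt)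
          (fun t ht => ?_) (fun t ht => ?_)
        all_goals
          rw [interior_Ici] at ht
          have ht' : T ≤ t := ht₁.trans (le_of_lt ht)
        · exact (h.1 t ht').differentiableAt.differentiableWithinAt
        · rw [(h.1 t ht').deriv]
          linarith [hx t ht']
      exact fun t ht => this Set.self_mem_Ici ht ht
    have hwle : ∀ t, t₁ ≤ t → n * x t - Real.exp (s t + 2 * t) * (1 - M * ρ t ^ q) ≤
        -(Real.exp (s t₁) * (1 - M * ρ t₁ ^ q)) := by
      intro t ht
      have ht' := ht₁.trans ht
      have h1 := mul_neg_of_pos_of_neg hn (hx t ht')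
      have h2 : Real.exp (s t₁) * (1 - M * ρ t₁ ^ q) ≤
          Real.exp (s t + 2 * t) * (1 - M * ρ t ^ q) := by
        have := hs t ht
        have := hρle t ht
        have := hρ0 t ht'
        have : 0 ≤ 1 - M * ρ t₁ ^ q := (sub_pos.2 hlt).le
        gcongr
        linarith
      linarith
    obtain ⟨t, ht, hlt'⟩ := exists_lt_of_hasDerivAt_le_neg
      (mul_pos (Real.exp_pos (s t₁)) (sub_pos.2 hlt)) (fun t ht => hw t (ht₁.trans ht)) hwle 0
    linarith [hx t (ht₁.trans ht)]
  · push Not at hcase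
    set c := (1 / M) ^ (1 / q) with hc
    have hc0 : 0 < c := by positivity
    have hρc : ∀ t, T ≤ t → c ≤ ρ t := by
      intro t ht
      rw [hc, one_div q, Real.rpow_inv_le_iff_of_pos (by positivity) (hρ0 t ht).le hq,
        div_le_iff₀ hM]
      linarith [hcase t ht]
    have hle : ∀ t, T ≤ t → Real.exp (-(s t / q)) * -(-x t / q) ≤ -(c / q) := by
      intro t ht
      have e1 : Real.exp (-(s t / q)) = Real.exp (-(s t / q) - t) * Real.exp t := by
        rw [← Real.exp_add]
        congr 1
        ring
      have e2 : Real.exp (-(s t / q)) * -(-x t / q) = -(ρ t * Real.exp t / q) := by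
        rw [e1, hρ]
        ring
      rw [e2, neg_le_neg_iff]
      have : 1 ≤ Real.exp t := Real.one_le_exp (hT.trans ht)
      gcongr
      nlinarith [hρc t ht]
    obtain ⟨t, ht, hlt⟩ := exists_lt_of_hasDerivAt_le_neg (f := fun t => Real.exp (-(s t / q)))
      (div_pos hc0 hq) (fun t ht => ((h.1 t ht).div_const q).neg.exp) hle 0
    exact (Real.exp_pos _).not_gt hlt

/-- From some time on the solution is nonincreasing, because `x' > 0` wherever `x = 0`. -/
theorem exists_forall_nonneg (h : IsLogTrajectory n M q T s x) (hn : 0 < n) (hM : 0 < M)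
    (hq : 0 < q) : ∃ T₁, 0 ≤ T₁ ∧ T ≤ T₁ ∧ ∀ t, T₁ ≤ t → 0 ≤ x t := by
  obtain ⟨T₁, hT₁, hx⟩ := (h.mono (le_max_left T 0)).exists_nonneg hn hM hq (le_max_right T 0)
  refine ⟨T₁, (le_max_right T 0).trans hT₁, (le_max_left T 0).trans hT₁, fun t ht => ?_⟩
  have := le_of_hasDerivAt_neg_of_eq (c := 0)
    (fun t ht => (h.2 t (((le_max_left T 0).trans hT₁).trans ht)).neg)
    (by simpa using hx) (fun t _ h0 => ?_) ht
  · simpa using this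
  · have h0' : x t = 0 := by simpa using h0
    rw [h0', abs_zero, Real.zero_rpow hq.ne']
    have := Real.exp_pos (s t + 2 * t)
    linarith

end IsLogTrajectory

/-! ### Superquadratic gradient term: Lyapunov function and Barbalat's lemma -/

namespace IsLogTrajectory

variable {n M q T : ℝ} {s x : ℝ → ℝ}

/-- For `q > 2` the Lyapunov function is `(x - 2)² / 2 + e^z - 2 n z` with `z = s + 2t`. Its
derivative is `-n (x - 2)²` plus a term whose positive part is integrable. -/
theorem tendsto_of_two_lt (h : IsLogTrajectory n M q T s x) (hn : 0 < n) (hM : 0 < M)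
    (hq : 2 < q) :
    Tendsto (fun t => Real.exp (s t + 2 * t)) atTop (𝓝 (2 * n)) ∧ Tendsto x atTop (𝓝 2) := by
  obtain ⟨T₁, hT₁0, hT₁, hx0⟩ := h.exists_forall_nonneg hn hM (by linarith)
  replace h := h.mono hT₁
  set ε := q - 2 with hε
  have hε0 : 0 < ε := by linarith
  set z : ℝ → ℝ := fun t => s t + 2 * t with hz
  set w : ℝ → ℝ := fun t => Real.exp (-(ε * t)) with hw
  have hw0 : ∀ t, 0 < w t := fun t => Real.exp_pos _
  have hw1 : ∀ t, T₁ ≤ t → w t ≤ 1 := fun t ht => by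
    have : 0 ≤ ε * t := mul_nonneg hε0.le (hT₁0.trans ht)
    exact Real.exp_le_one_iff.2 (by linarith)
  have hwt : Tendsto w atTop (𝓝 0) :=
    Real.tendsto_exp_neg_atTop_nhds_zero.comp (tendsto_id.const_mul_atTop hε0)
  have hzd : ∀ t, T₁ ≤ t → HasDerivAt z (2 - x t) t := fun t ht => by
    refine ((h.1 t ht).add ((hasDerivAt_id t).const_mul 2)).congr_deriv ?_
    ring
  have hxd : ∀ t, T₁ ≤ t → HasDerivAt x
      (-(n * x t) + Real.exp (z t) - M * w t * x t ^ q) t := fun t ht => by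
    refine (h.2 t ht).congr_deriv ?_
    rw [abs_of_nonneg (hx0 t ht), hw, hz, hε]
    congr 4
    ring
  set E : ℝ → ℝ := fun t => (x t - 2) ^ 2 / 2 + (Real.exp (z t) - 2 * n * z t) with hE
  set g : ℝ → ℝ := fun t => -(n * (x t - 2) ^ 2) with hg
  set k : ℝ → ℝ := fun t => -(M * w t * x t ^ q * (x t - 2)) with hk
  have hEd : ∀ t, T₁ ≤ t → HasDerivAt E (g t + k t) t := fun t ht => by
    refine (((((hxd t ht).sub_const 2).pow 2).div_const 2).add
      ((hzd t ht).exp.sub ((hzd t ht).const_mul (2 * n)))).congr_deriv ?_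
    simp only [hg, hk]
    ring
  have hEle : ∀ t, T₁ ≤ t → g t + k t ≤ M * (2 ^ q * 2) * Real.exp (-(ε * t)) := by
    intro t ht
    have hx := hx0 t ht
    have h1 : g t ≤ 0 := by
      simp only [hg]
      have : 0 ≤ n * (x t - 2) ^ 2 := by positivity
      linarith
    have h2 : x t ^ q * (2 - x t) ≤ 2 ^ q * 2 := by
      rcases le_total (x t) 2 with h2 | h2
      · have : 0 ≤ 2 - x t := by linarith
        gcongr
        linarith
      · have : x t ^ q * (2 - x t) ≤ 0 :=
          mul_nonpos_of_nonneg_of_nonpos (by positivity) (by linarith)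
        exact this.trans (by positivity)
    have h3 : k t = M * (x t ^ q * (2 - x t)) * w t := by
      simp only [hk]
      ring
    have h4 : M * (x t ^ q * (2 - x t)) * w t ≤ M * (2 ^ q * 2) * w t := by
      have := (hw0 t).le
      gcongr
    linarith
  obtain ⟨B, hB⟩ := exists_le_of_hasDerivAt_le_exp hε0 (by positivity) hEd hEle
  obtain ⟨Z, hZ⟩ := exists_abs_le_of_exp_sub_mul_le (a := 2 * n) (by positivity) B
  have hzb : ∀ t, T₁ ≤ t → |z t| ≤ Z := fun t ht => hZ _ (by
    have := hB t ht
    simp only [hE] at this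
    linarith [sq_nonneg (x t - 2)])
  have hnz : ∀ t, T₁ ≤ t → 2 * n * z t ≤ 2 * n * Z := fun t ht => by
    have := (le_abs_self _).trans (hzb t ht)
    gcongr
  have hez : ∀ t, T₁ ≤ t → Real.exp (z t) ≤ Real.exp Z := fun t ht =>
    Real.exp_le_exp.2 ((le_abs_self _).trans (hzb t ht))
  -- from `v² ≤ A` one gets `v ≤ A + 1`
  set X := 2 + (2 * (B + 2 * n * Z) + 1) with hX
  have hxX : ∀ t, T₁ ≤ t → x t ≤ X := by
    intro t ht
    have h1 := hB t ht
    simp only [hE] at h1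
    have h2 := Real.exp_pos (z t)
    have h3 := hnz t ht
    have h4 : (x t - 2) ^ 2 ≤ 2 * (B + 2 * n * Z) := by linarith
    nlinarith [sq_nonneg (x t - 2 - 1)]
  have hX0 : 0 ≤ X := (hx0 T₁ le_rfl).trans (hxX T₁ le_rfl)
  have hxq : ∀ t, T₁ ≤ t → x t ^ q ≤ X ^ q := fun t ht =>
    Real.rpow_le_rpow (hx0 t ht) (hxX t ht) (by linarith)
  have hx2 : ∀ t, T₁ ≤ t → |x t - 2| ≤ X + 2 := fun t ht => by
    rw [abs_le]
    constructor <;> linarith [hx0 t ht, hxX t ht]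
  -- the gradient term vanishes in the limit
  have hpert : Tendsto (fun t => M * w t * x t ^ q) atTop (𝓝 0) := by
    refine squeeze_zero' (g := fun t => M * w t * X ^ q) ?_ ?_ (by
      simpa using (hwt.const_mul M).mul_const (X ^ q))
    · filter_upwards [eventually_ge_atTop T₁] with t ht
      have := hx0 t ht
      have := hw0 t
      positivity
    · filter_upwards [eventually_ge_atTop T₁] with t ht
      have := hw0 t
      have := hxq t ht
      gcongr
  have hk0 : Tendsto k atTop (𝓝 0) := by
    refine squeeze_zero_norm' (a := fun t => M * w t * x t ^ q * (X + 2)) ?_ (by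
      simpa using hpert.mul_const (X + 2))
    filter_upwards [eventually_ge_atTop T₁] with t ht
    have := hx0 t ht
    have := hw0 t
    have h1 : 0 ≤ M * w t * x t ^ q := by positivity
    simp only [hk]
    rw [Real.norm_eq_abs, abs_neg, abs_mul, abs_of_nonneg h1]
    exact mul_le_mul_of_nonneg_left (hx2 t ht) h1
  have hxd' : ∀ t, T₁ ≤ t → |-(n * x t) + Real.exp (z t) - M * w t * x t ^ q| ≤
      n * X + Real.exp Z + M * X ^ q := by
    intro t ht
    have h1 := hx0 t ht
    have h2 := hw0 t
    have h3 : 0 ≤ M * w t * x t ^ q := by positivity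
    have h4 : M * w t * x t ^ q ≤ M * 1 * X ^ q := by
      have := hw1 t ht
      have := hxq t ht
      gcongr
    have h5 : n * x t ≤ n * X := mul_le_mul_of_nonneg_left (hxX t ht) hn.le
    have h6 : 0 ≤ n * x t := by positivity
    have h7 := Real.exp_pos (z t)
    have h8 := hez t ht
    rw [abs_le]
    constructor <;> linarith
  obtain ⟨l, hl⟩ := exists_tendsto_of_hasDerivAt_le_exp (B := -(2 * n * Z)) hε0 hEd hEle
    (fun t ht => by
      simp only [hE]
      linarith [sq_nonneg (x t - 2), Real.exp_pos (z t), hnz t ht]) (by positivity)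
  -- the Lyapunov function converges, so its dissipation rate tends to zero
  have hg0 : Tendsto g atTop (𝓝 0) := by
    refine tendsto_zero_of_tendsto_of_hasDerivAt_add hEd
      (K := 2 * n * (X + 2) * (n * X + Real.exp Z + M * X ^ q))
      (fun t ht => ((((hxd t ht).sub_const 2).pow 2).const_mul n).neg) (fun t ht => ?_) hl hk0
    have e : -(n * (((2 : ℕ) : ℝ) * (x t - 2) ^ (2 - 1) *
        (-(n * x t) + Real.exp (z t) - M * w t * x t ^ q))) =
        -(2 * n) * (x t - 2) * (-(n * x t) + Real.exp (z t) - M * w t * x t ^ q) := by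
      push_cast
      ring
    rw [e, abs_mul, abs_mul, abs_neg, abs_of_pos (by positivity : 0 < 2 * n)]
    exact mul_le_mul (mul_le_mul_of_nonneg_left (hx2 t ht) (by positivity)) (hxd' t ht)
      (abs_nonneg _) (by positivity)
  have hx : Tendsto x atTop (𝓝 2) := by
    have h1 : Tendsto (fun t => (x t - 2) ^ 2) atTop (𝓝 0) := by
      have := hg0.const_mul (-(1 / n))
      rw [mul_zero] at this
      refine this.congr fun t => ?_
      simp only [hg]
      field_simp
    have h2 : Tendsto (fun t => x t - 2) atTop (𝓝 0) := by
      rw [tendsto_zero_iff_abs_tendsto_zero]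
      simpa [Real.sqrt_sq_eq_abs, Function.comp_def] using h1.sqrt
    simpa using h2.add_const 2
  refine ⟨?_, hx⟩
  -- apply the same principle to `x' = (e^z - 2 n) + o(1)`, since `x` converges
  have hy : Tendsto (fun t => Real.exp (z t) - 2 * n) atTop (𝓝 0) := by
    refine tendsto_zero_of_tendsto_of_hasDerivAt_add (f := x)
      (h := fun t => -(n * (x t - 2)) - M * w t * x t ^ q) (K := Real.exp Z * (X + 2))
      (fun t ht => (hxd t ht).congr_deriv (by ring)) (fun t ht => (hzd t ht).exp.sub_const _)
      (fun t ht => ?_) hx (by simpa using ((hx.sub_const 2).const_mul n).neg.sub hpert)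
    rw [abs_mul, abs_of_pos (Real.exp_pos _), abs_sub_comm]
    exact mul_le_mul (hez t ht) (hx2 t ht) (abs_nonneg _) (Real.exp_pos _).le
  simpa using hy.add_const (2 * n)

end IsLogTrajectory

/-! ### Subquadratic gradient term: a fast-slow system -/

/-- To the right of `p`, the power `x ^ q` lies above the line through `0` and `(p, p ^ q)`. -/
theorem sub_mul_rpow_le_of_le {p x q : ℝ} (hq : 1 ≤ q) (hp : 0 < p) (hpx : p ≤ x) :
    (x - p) * p ^ (q - 1) ≤ x ^ q - p ^ q := by
  have hx : 0 < x := hp.trans_le hpx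
  have e1 : x ^ q = x * x ^ (q - 1) := by
    rw [Real.rpow_sub_one hx.ne']
    field_simp
  have e2 : p ^ q = p * p ^ (q - 1) := by
    rw [Real.rpow_sub_one hp.ne']
    field_simp
  have h : p ^ (q - 1) ≤ x ^ (q - 1) := Real.rpow_le_rpow hp.le hpx (by linarith)
  rw [e1, e2]
  nlinarith

/-- To the left of `p`, the power `x ^ q` lies below the line through `0` and `(p, p ^ q)`. -/
theorem sub_mul_rpow_le_of_ge {p x q : ℝ} (hq : 1 < q) (hx : 0 ≤ x) (hp : 0 < p) (hpx : x ≤ p) :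
    (p - x) * p ^ (q - 1) ≤ p ^ q - x ^ q := by
  have e1 : x ^ q = x * x ^ (q - 1) := by
    rcases hx.eq_or_lt with rfl | hx
    · rw [Real.zero_rpow (by linarith), zero_mul]
    · rw [Real.rpow_sub_one hx.ne']
      field_simp
  have e2 : p ^ q = p * p ^ (q - 1) := by
    rw [Real.rpow_sub_one hp.ne']
    field_simp
  have h : x ^ (q - 1) ≤ p ^ (q - 1) := Real.rpow_le_rpow hx hpx (by linarith)
  rw [e1, e2]
  nlinarith

/-- The fast variable follows the slow one: if `x' = -n x + M e^{εt} (p^q - x^q)`, where `p` stays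
in a compact subset of `(0, ∞)` and `p' = p (q - x) / q`, then `x - p → 0`. -/
theorem tendsto_sub_of_fast_slow {n M q ε T p₀ P : ℝ} {x p : ℝ → ℝ} (hn : 0 < n) (hM : 0 < M)
    (hq : 1 < q) (hε : 0 < ε) (hp₀ : 0 < p₀) (hx0 : ∀ t, T ≤ t → 0 ≤ x t)
    (hx : ∀ t, T ≤ t → HasDerivAt x
      (-(n * x t) + Real.exp (ε * t) * (M * p t ^ q - M * x t ^ q)) t)
    (hp : ∀ t, T ≤ t → HasDerivAt p (p t * (q - x t) / q) t)
    (hpl : ∀ t, T ≤ t → p₀ ≤ p t) (hpu : ∀ t, T ≤ t → p t ≤ P) :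
    Tendsto (fun t => x t - p t) atTop (𝓝 0) := by
  have hq0 : 0 < q := by linarith
  have hP : 0 < P := hp₀.trans_le ((hpl T le_rfl).trans (hpu T le_rfl))
  have hfast : ∀ A : ℝ, ∀ᶠ t in atTop, A ≤ Real.exp (ε * t) * (M * p₀ ^ (q - 1)) := fun A =>
    ((Real.tendsto_exp_atTop.comp (tendsto_id.const_mul_atTop hε)).atTop_mul_const
      (by positivity : 0 < M * p₀ ^ (q - 1))).eventually_ge_atTop A
  have hpow : ∀ t, T ≤ t → p₀ ^ (q - 1) ≤ p t ^ (q - 1) := fun t ht =>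
    Real.rpow_le_rpow hp₀.le (hpl t ht) (by linarith)
  refine tendsto_of_forall_eventually_le (fun δ hδ => ?_) (fun δ hδ => ?_)
  · simp only [sub_zero]
    refine eventually_le_of_hasDerivAt_le_neg (f := fun t => x t - p t) hδ
      ((eventually_ge_atTop T).mono fun t ht => (hx t ht).sub (hp t ht)) ?_
    filter_upwards [eventually_ge_atTop T, hfast (P / q * (1 + P / δ) + 1)] with t ht hA hd
    have hpt : 0 < p t := hp₀.trans_le (hpl t ht)
    have h0 : 0 ≤ x t - p t := hδ.le.trans hd
    have h1 : (x t - p t) * (Real.exp (ε * t) * (M * p₀ ^ (q - 1))) ≤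
        Real.exp (ε * t) * (M * x t ^ q - M * p t ^ q) := by
      have h2 := (mul_le_mul_of_nonneg_left (hpow t ht) h0).trans
        (sub_mul_rpow_le_of_le hq.le hpt (by linarith))
      calc (x t - p t) * (Real.exp (ε * t) * (M * p₀ ^ (q - 1)))
          = Real.exp (ε * t) * (M * ((x t - p t) * p₀ ^ (q - 1))) := by ring
        _ ≤ Real.exp (ε * t) * (M * (x t ^ q - p t ^ q)) := by gcongr
        _ = _ := by ring
    have h3 := mul_le_mul_of_nonneg_left hA h0
    -- `x` has no a priori bound, but it is at most a multiple of `x - p` here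
    have h4 : x t ≤ (x t - p t) * (1 + P / δ) := by
      have : p t ≤ (x t - p t) * (P / δ) := by
        calc p t ≤ P := hpu t ht
          _ = δ * (P / δ) := by field_simp
          _ ≤ _ := by gcongr
      linarith
    have h5 : p t * x t / q ≤ P / q * ((x t - p t) * (1 + P / δ)) := by
      calc p t * x t / q = p t / q * x t := by ring
        _ ≤ P / q * x t := by
          have := hpu t ht
          have := hx0 t ht
          gcongr
        _ ≤ _ := by gcongr
    have h6 : p t * (q - x t) / q = p t - p t * x t / q := by
      field_simp
    have h7 : 0 ≤ n * x t := mul_nonneg hn.le (hx0 t ht)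
    linarith
  · simp only [zero_sub, neg_sub]
    refine eventually_le_of_hasDerivAt_le_neg (f := fun t => p t - x t) one_pos
      ((eventually_ge_atTop T).mono fun t ht => (hp t ht).sub (hx t ht)) ?_
    filter_upwards [eventually_ge_atTop T, hfast ((P + n * P + 1) / δ)] with t ht hA hd
    have hpt : 0 < p t := hp₀.trans_le (hpl t ht)
    have h1 : δ * (Real.exp (ε * t) * (M * p₀ ^ (q - 1))) ≤
        Real.exp (ε * t) * (M * p t ^ q - M * x t ^ q) := by
      have h2 : δ * p₀ ^ (q - 1) ≤ p t ^ q - x t ^ q :=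
        (mul_le_mul hd (hpow t ht) (by positivity) (by linarith)).trans
        (sub_mul_rpow_le_of_ge hq (hx0 t ht) hpt (by linarith))
      calc δ * (Real.exp (ε * t) * (M * p₀ ^ (q - 1)))
          = Real.exp (ε * t) * (M * (δ * p₀ ^ (q - 1))) := by ring
        _ ≤ Real.exp (ε * t) * (M * (p t ^ q - x t ^ q)) := by gcongr
        _ = _ := by ring
    rw [div_le_iff₀ hδ] at hA
    have h6 : p t * (q - x t) / q = p t - p t * x t / q := by
      field_simp
    have h7 : 0 ≤ p t * x t / q := by
      have := hx0 t ht
      positivity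
    have h8 : n * x t ≤ n * P :=
      mul_le_mul_of_nonneg_left (by linarith [hpu t ht]) hn.le
    linarith [hpu t ht]

/-- On the slow manifold `x = p` the equation `p' = p (q - x) / q` is logistic, so `p → q`. -/
theorem tendsto_of_slow {q T p₀ : ℝ} {x p : ℝ → ℝ} (hq : 0 < q) (hp₀ : 0 < p₀)
    (hp : ∀ t, T ≤ t → HasDerivAt p (p t * (q - x t) / q) t)
    (hpl : ∀ t, T ≤ t → p₀ ≤ p t) (hxp : Tendsto (fun t => x t - p t) atTop (𝓝 0)) :
    Tendsto p atTop (𝓝 q) := by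
  have hsmall : ∀ δ > 0, ∀ᶠ t in atTop, |x t - p t| ≤ δ := fun δ hδ => by
    filter_upwards [Metric.tendsto_nhds.1 hxp δ hδ] with t ht
    rw [Real.dist_eq, sub_zero] at ht
    exact ht.le
  refine tendsto_of_forall_eventually_le (fun δ hδ => ?_) (fun δ hδ => ?_)
  · refine eventually_le_of_hasDerivAt_le_neg (f := fun t => p t - q)
      (η := p₀ * (δ / 2) / q) (by positivity)
      ((eventually_ge_atTop T).mono fun t ht => (hp t ht).sub_const q) ?_
    filter_upwards [eventually_ge_atTop T, hsmall (δ / 2) (by positivity)] with t ht hs hd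
    rw [abs_le] at hs
    rw [← neg_div]
    have := hpl t ht
    gcongr
    nlinarith
  · refine eventually_le_of_hasDerivAt_le_neg (f := fun t => q - p t)
      (η := p₀ * (δ / 2) / q) (by positivity)
      ((eventually_ge_atTop T).mono fun t ht => (hp t ht).const_sub q) ?_
    filter_upwards [eventually_ge_atTop T, hsmall (δ / 2) (by positivity)] with t ht hs hd
    rw [abs_le] at hs
    rw [neg_le_neg_iff]
    have := hpl t ht
    gcongr <;> linarith

namespace IsLogTrajectory

variable {n M q T : ℝ} {s x : ℝ → ℝ}

/-- For `1 < q < 2` the Lyapunov function is `e^{-(2-q)t} (x - q)² / 2 + e^z - M q^q z` with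
`z = s + qt`. It bounds `z`, after which the fast-slow structure of the system takes over. -/
theorem tendsto_of_lt_two (h : IsLogTrajectory n M q T s x) (hn : 0 < n) (hM : 0 < M)
    (hq : 1 < q) (hq2 : q < 2) :
    Tendsto (fun t => Real.exp (s t + q * t)) atTop (𝓝 (M * q ^ q)) ∧ Tendsto x atTop (𝓝 q) := by
  have hq0 : 0 < q := by linarith
  obtain ⟨T₁, hT₁0, hT₁, hx0⟩ := h.exists_forall_nonneg hn hM hq0
  replace h := h.mono hT₁
  set ε := 2 - q with hε
  have hε0 : 0 < ε := by linarith
  set z : ℝ → ℝ := fun t => s t + q * t with hz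
  set w : ℝ → ℝ := fun t => Real.exp (-(ε * t)) with hw
  have hw0 : ∀ t, 0 < w t := fun t => Real.exp_pos _
  have hww : ∀ t, w t * Real.exp (ε * t) = 1 := fun t => by
    rw [hw, ← Real.exp_add, neg_add_cancel, Real.exp_zero]
  have hzd : ∀ t, T₁ ≤ t → HasDerivAt z (q - x t) t := fun t ht => by
    refine ((h.1 t ht).add ((hasDerivAt_id t).const_mul q)).congr_deriv ?_
    ring
  have hwd : ∀ t, HasDerivAt w (-(ε * w t)) t := fun t => by
    refine ((hasDerivAt_id t).const_mul ε).neg.exp.congr_deriv ?_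
    simp [hw]
    ring
  have hxd : ∀ t, T₁ ≤ t → HasDerivAt x
      (-(n * x t) + Real.exp (ε * t) * (Real.exp (z t) - M * x t ^ q)) t := fun t ht => by
    refine (h.2 t ht).congr_deriv ?_
    have : Real.exp (s t + 2 * t) = Real.exp (ε * t) * Real.exp (z t) := by
      rw [← Real.exp_add]
      congr 1
      simp only [hz, hε]
      ring
    rw [abs_of_nonneg (hx0 t ht), this]
    ring
  set a := M * q ^ q with ha
  have ha0 : 0 < a := by positivity
  set E : ℝ → ℝ := fun t => w t * (x t - q) ^ 2 / 2 + (Real.exp (z t) - a * z t) with hE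
  have hEd : ∀ t, T₁ ≤ t → HasDerivAt E
      (-(ε * w t * (x t - q) ^ 2 / 2) - n * w t * x t * (x t - q)
        - M * ((x t - q) * (x t ^ q - q ^ q))) t := fun t ht => by
    refine ((((hwd t).mul (((hxd t ht).sub_const q).pow 2)).div_const 2).add
      ((hzd t ht).exp.sub ((hzd t ht).const_mul a))).congr_deriv ?_
    simp only [ha, Pi.pow_apply]
    push_cast
    linear_combination ((x t - q) * (Real.exp (z t) - M * x t ^ q)) * hww t
  obtain ⟨B, hB⟩ := exists_le_of_hasDerivAt_le_exp (C := n * q ^ 2) hε0 (by positivity) hEd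
    (fun t ht => by
      have h0 := hx0 t ht
      have h1 : 0 ≤ ε * w t * (x t - q) ^ 2 / 2 := by
        have := hw0 t
        positivity
      have h2 : 0 ≤ (x t - q) * (x t ^ q - q ^ q) := by
        rcases le_total q (x t) with h3 | h3
        · have := Real.rpow_le_rpow hq0.le h3 hq0.le
          exact mul_nonneg (by linarith) (by linarith)
        · have := Real.rpow_le_rpow h0 h3 hq0.le
          exact mul_nonneg_of_nonpos_of_nonpos (by linarith) (by linarith)
      have h3 : x t * (q - x t) ≤ q ^ 2 := by nlinarith [sq_nonneg (x t - q)]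
      have h4 := mul_le_mul_of_nonneg_left h3 (mul_nonneg hn.le (hw0 t).le)
      have h5 := mul_nonneg hM.le h2
      change _ ≤ n * q ^ 2 * w t
      linarith)
  obtain ⟨Z, hZ⟩ := exists_abs_le_of_exp_sub_mul_le ha0 B
  have hzb : ∀ t, T₁ ≤ t → |z t| ≤ Z := fun t ht => hZ _ (by
    have h1 := hB t ht
    simp only [hE] at h1
    have h2 : 0 ≤ w t * (x t - q) ^ 2 / 2 := by
      have := hw0 t
      positivity
    linarith)
  -- `p` is the value of `x` at which the bracket `e^z - M x^q` vanishes
  set p : ℝ → ℝ := fun t => Real.exp ((z t - Real.log M) / q) with hp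
  have hpq : ∀ t, M * p t ^ q = Real.exp (z t) := fun t => by
    rw [hp, ← Real.exp_mul, div_mul_cancel₀ _ hq0.ne', Real.exp_sub, Real.exp_log hM]
    field_simp
  have hpd : ∀ t, T₁ ≤ t → HasDerivAt p (p t * (q - x t) / q) t := fun t ht => by
    refine (((hzd t ht).sub_const (Real.log M)).div_const q).exp.congr_deriv ?_
    simp only [hp]
    ring
  have hpl : ∀ t, T₁ ≤ t → Real.exp ((-Z - Real.log M) / q) ≤ p t := fun t ht => by
    have := (abs_le.1 (hzb t ht)).1
    simp only [hp]
    gcongr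
  have hpu : ∀ t, T₁ ≤ t → p t ≤ Real.exp ((Z - Real.log M) / q) := fun t ht => by
    have := (abs_le.1 (hzb t ht)).2
    simp only [hp]
    gcongr
  have hxp := tendsto_sub_of_fast_slow hn hM hq hε0 (Real.exp_pos _) hx0
    (fun t ht => by simpa only [hpq] using hxd t ht) hpd hpl hpu
  have hplim := tendsto_of_slow hq0 (Real.exp_pos _) hpd hpl hxp
  refine ⟨?_, by simpa using hxp.add hplim⟩
  refine ((hplim.rpow_const (Or.inl hq0.ne')).const_mul M).congr fun t => hpq t

end IsLogTrajectory

/-! ### Return to the variable `r` -/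

/-- The change of variable `t = log r` turns the radial equation in dimension `d` into the system of
`IsLogTrajectory` with `n = d - 2`. -/
theorem isLogTrajectory_of_radial_ode {d M q r₀ : ℝ} {u : ℝ → ℝ}
    (hu : ∀ r, r₀ < r → HasDerivAt u (deriv u r) r ∧ HasDerivAt (deriv u)
      (M * |deriv u r| ^ q - Real.exp (u r) - (d - 1) / r * deriv u r) r) (hr₀ : 0 < r₀) :
    IsLogTrajectory (d - 2) M q (Real.log r₀ + 1) (fun t => u (Real.exp t))
      (fun t => -(Real.exp t * deriv u (Real.exp t))) := by
  have hlt : ∀ t, Real.log r₀ + 1 ≤ t → r₀ < Real.exp t := fun t ht =>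
    (Real.log_lt_iff_lt_exp hr₀).1 (by linarith)
  refine ⟨fun t ht => ?_, fun t ht => ?_⟩
  · refine ((hu _ (hlt t ht)).1.comp t (Real.hasDerivAt_exp t)).congr_deriv ?_
    ring
  · refine ((Real.hasDerivAt_exp t).mul
      ((hu _ (hlt t ht)).2.comp t (Real.hasDerivAt_exp t))).neg.congr_deriv ?_
    have e1 : Real.exp (u (Real.exp t) + 2 * t) =
        Real.exp t * Real.exp t * Real.exp (u (Real.exp t)) := by
      rw [← Real.exp_add, ← Real.exp_add]
      congr 1
      ring
    have e2 : Real.exp ((2 - q) * t) * |-(Real.exp t * deriv u (Real.exp t))| ^ q =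
        Real.exp t * Real.exp t * |deriv u (Real.exp t)| ^ q := by
      rw [abs_neg, abs_mul, abs_of_pos (Real.exp_pos t),
        Real.mul_rpow (Real.exp_pos t).le (abs_nonneg _), ← Real.exp_mul, ← mul_assoc,
        ← Real.exp_add, ← Real.exp_add]
      congr 2
      ring
    rw [e1, mul_assoc M, e2]
    have h0 := (Real.exp_pos t).ne'
    simp only [Function.comp_apply]
    field_simp
    ring

theorem theoremE (N : ℕ) (hN : 3 ≤ N) (M q r₀ : ℝ) (hM : 0 < M) (hr₀ : 0 < r₀)
    (U : EuclideanSpace ℝ (Fin N) → ℝ) (u : ℝ → ℝ)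
    (hU : IsSolutionIn M q U (exteriorDomain N r₀))
    (hu : IsRadialIn U (exteriorDomain N r₀) u) :
    (1 < q → q < 2 →
      Filter.Tendsto (fun r : ℝ => r ^ q * Real.exp (u r)) Filter.atTop (nhds (M * q ^ q)) ∧
      Filter.Tendsto (fun r : ℝ => r * deriv u r) Filter.atTop (nhds (-q))) ∧
    (2 < q →
      Filter.Tendsto (fun r : ℝ => r ^ 2 * Real.exp (u r)) Filter.atTop
        (nhds (2 * ((N : ℝ) - 2))) ∧
      Filter.Tendsto (fun r : ℝ => r * deriv u r) Filter.atTop (nhds (-2))) := by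
  have htraj := isLogTrajectory_of_radial_ode
    (fun r hr => hU.radial_ode hr₀.le (by omega) hu hr) hr₀
  have hn : (0 : ℝ) < N - 2 := by
    have : (3 : ℝ) ≤ N := by exact_mod_cast hN
    linarith
  refine ⟨fun h1 h2 => ?_, fun h2 => ?_⟩
  · obtain ⟨hy, hx⟩ := htraj.tendsto_of_lt_two hn hM h1 h2
    refine ⟨(hy.comp Real.tendsto_log_atTop).congr' ?_,
      (hx.comp Real.tendsto_log_atTop).neg.congr' ?_⟩
    all_goals filter_upwards [eventually_gt_atTop 0] with r hr
    · simp only [Function.comp_apply]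
      rw [Real.exp_add, Real.exp_log hr, Real.rpow_def_of_pos hr, mul_comm q, mul_comm]
    · simp [Real.exp_log hr]
  · obtain ⟨hy, hx⟩ := htraj.tendsto_of_two_lt hn hM h2
    refine ⟨(hy.comp Real.tendsto_log_atTop).congr' ?_,
      (hx.comp Real.tendsto_log_atTop).neg.congr' ?_⟩
    all_goals filter_upwards [eventually_gt_atTop 0] with r hr
    · simp only [Function.comp_apply]
      rw [Real.exp_add, Real.exp_log hr, two_mul, Real.exp_add, Real.exp_log hr]
      ring
    · simp [Real.exp_log hr]
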